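/- All hypergraphs are finite. A hypergraph $H$ is given by a finite set $V$ of hypervertices, a finite set $E$ of hyperedges, and an incidence relation between them, i.e. by its bipartite incidence graph, with sides $V$ and $E$; write $N_H(x)$ for the set of neighbours of $x$ in this graph. $H$ is balanced if its incidence graph has no induced (strong) cycle of length $4k+2$ with $k\ge 1$. A matching of $H$ is a set $M\subseteq E$ such that every hypervertex is incident to at most one member of $M$; it covers $U\subseteq V$ if every $u\in U$ is incident to a member of $M$. Let $H$ be a balanced hypergraph, and let $U\subseteq V$ be an independent transversal of $H$, i.e. every hyperedge is incident to at most one (independent) and at least one (transversal) element of $U$. Let $H'$, with hypervertex set $V'$ and hyperedge set $E'$, be obtained from $H$ by adding two new hypervertices $v_0,v_1$, a new hyperedge $e_0$ with $N_{H'}(e_0)=\{v_0,v_1\}$, and for each $u\in U$ a new hyperedge $f_u$ with $N_{H'}(f_u)=\{v_1,u\}$. For $\sigma:V'\to E'\cup\{\perp\}$ and $u\in V'$ let $N_\sigma(u)$ be the set of all $v\in V'\setminus\{u\}$ such that $\sigma(v)$ is a hyperedge incident to $u$ in $H'$. An assignment for $(H',v_0)$ is a pair $(R,\sigma)$ with $R\subseteq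 V'$, $v_0\in R$ and $\sigma:V'\to E'\cup\{\perp\}$ such that: ($C_1$) for $v\in R$, if $\sigma(v)=e\in E'$, then $e\in N_{H'}(v)$, and every $u\in N_{H'}(e)\setminus\{v\}$ satisfies $u\in R$ and $\sigma(u)=\perp$; ($C_2$) for $v\in R$, if $\sigma(v)=\perp$, then for every $e\in N_{H'}(v)$ there exists $u\in N_{H'}(e)$ with $u\in R$ and $\sigma(u)\ne\perp$; ($C_3$) $|N_\sigma(v)|\le 1$ for every $v\in R$, and $N_\sigma(v_0)=\emptyset$. Then: 1. If $H$ has a matching covering $U$, there is an assignment $(R,\sigma)$ for $(H',v_0)$ with $\sigma(v_0)\neq\perp$. 2. If $H$ has no matching covering $U$, there is an assignment $(R,\sigma)$ for $(H',v_0)$ with $\sigma(v_0)=\perp$. In particular, an assignment for $(H',v_0)$ always exists. -/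

import Mathlib

/-- A hypergraph with hypervertices `V` and hyperedges `E`, given by its incidence relation.
Parallel hyperedges are allowed. -/
structure IncHypergraph (V E : Type*) where
  /-- `Inc v e`: the hypervertex `v` is incident to the hyperedge `e`. -/
  Inc : V → E → Prop

namespace IncHypergraph

/-- The incidence graph, a bipartite graph with sides `V` and `E`. -/
def graph {V E : Type*} (H : IncHypergraph V E) : SimpleGraph (V ⊕ E) where
  Adj
    | Sum.inl v, Sum.inr e => H.Inc v e
    | Sum.inr e, Sum.inl v => H.Inc v e
    | _, _ => False
  symm := ⟨by rintro (a | a) (b | b) h <;> exact h⟩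
  loopless := ⟨by rintro (a | a) h <;> exact h⟩

/-- The hyperedges incident to a hypervertex. -/
def edgesAt {V E : Type*} (H : IncHypergraph V E) (v : V) : Set E := {e | H.Inc v e}

/-- The hypervertices incident to a hyperedge. -/
def vertsOf {V E : Type*} (H : IncHypergraph V E) (e : E) : Set V := {v | H.Inc v e}

/-- A closed walk of the incidence graph is a strong cycle if it is a cycle and the only edges of
the incidence graph between its vertices are the edges of the cycle. -/
def IsStrongCycle {V E : Type*} (H : IncHypergraph V E) {z : V ⊕ E} (C : H.graph.Walk z z) :
    Prop :=
  C.IsCycle ∧ ∀ x ∈ C.support, ∀ y ∈ C.support, H.graph.Adj x y → s(x, y) ∈ C.edges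

/-- There is no strong cycle of length `4k + 2` with `k ≥ 1` in the incidence graph. -/
def Balanced {V E : Type*} (H : IncHypergraph V E) : Prop :=
  ∀ (z : V ⊕ E) (C : H.graph.Walk z z), H.IsStrongCycle C → ∀ k : ℕ, 1 ≤ k → C.length ≠ 4 * k + 2

/-- Each hypervertex is incident to at most one hyperedge of `M`. -/
def IsMatching {V E : Type*} (H : IncHypergraph V E) (M : Set E) : Prop :=
  ∀ v, (H.edgesAt v ∩ M).Subsingleton

/-- Each hypervertex of `U` is incident to at least one hyperedge of `M`. -/
def Covers {V E : Type*} (H : IncHypergraph V E) (M : Set E) (U : Set V) : Prop :=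
  ∀ v ∈ U, (H.edgesAt v ∩ M).Nonempty

/-- Each hyperedge is incident to at most one hypervertex of `S`. -/
def IsIndependent {V E : Type*} (H : IncHypergraph V E) (S : Set V) : Prop :=
  ∀ e, (H.vertsOf e ∩ S).Subsingleton

/-- Each hyperedge is incident to at least one hypervertex of `T`. -/
def IsTransversal {V E : Type*} (H : IncHypergraph V E) (T : Set V) : Prop :=
  ∀ e, (H.vertsOf e ∩ T).Nonempty

/-- The hypervertices of the augmented hypergraph: those of `H`, and two new ones. -/
inductive AugVertex (V : Type*) where
  | v₀ : AugVertex V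
  | v₁ : AugVertex V
  | old (v : V) : AugVertex V

/-- The hyperedges of the augmented hypergraph: those of `H`, a new one `e₀`, and a new one `f u`
for each `u ∈ U`. -/
inductive AugEdge {V : Type*} (E : Type*) (U : Set V) where
  | e₀ : AugEdge E U
  | f (u : U) : AugEdge E U
  | old (e : E) : AugEdge E U

/-- The augmented hypergraph: `H` together with `e₀ = {v₀, v₁}` and `f u = {v₁, u}`
for `u ∈ U`. -/
def augment {V E : Type*} (H : IncHypergraph V E) (U : Set V) :
    IncHypergraph (AugVertex V) (AugEdge E U) where
  Inc
    | .v₀, .e₀ => True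
    | .v₁, .e₀ => True
    | .v₁, .f _ => True
    | .old v, .f u => v = u
    | .old v, .old e => H.Inc v e
    | _, _ => False

/-- The set `N_σ(u)` of the hypervertices `v ≠ u` such that `σ v` is a hyperedge incident to `u`;
the value `none` plays the role of `⊥`. -/
def sigmaNbrs {V E : Type*} (H : IncHypergraph V E) (σ : V → Option E) (u : V) : Set V :=
  {v | v ≠ u ∧ ∃ e, σ v = some e ∧ H.Inc u e}

/-- `(R, σ)` is an assignment for `(H, v₀)`. -/
structure IsAssignment {V E : Type*} (H : IncHypergraph V E) (v₀ : V) (R : Set V)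
    (σ : V → Option E) : Prop where
  start_mem : v₀ ∈ R
  winning : ∀ v ∈ R, ∀ e, σ v = some e →
    e ∈ H.edgesAt v ∧ ∀ u ∈ H.vertsOf e, u ≠ v → u ∈ R ∧ σ u = none
  losing : ∀ v ∈ R, σ v = none → ∀ e ∈ H.edgesAt v, ∃ u ∈ H.vertsOf e, u ∈ R ∧ σ u ≠ none
  nbrs_subsingleton : ∀ v ∈ R, (H.sigmaNbrs σ v).Subsingleton
  nbrs_start : H.sigmaNbrs σ v₀ = ∅

end IncHypergraph

/-! In both cases `R` is everything. A matching covering `U` yields σ directly: each `u ∈ U` picks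
its matching edge and `v₀` picks `e₀`. Otherwise the König property of balanced hypergraphs gives a
matching `M` and a transversal `B` with `|B| ≤ |M|`, so incidence pairs `M` with `B` bijectively.
Each vertex of `B` picks its edge of `M`, and `v₁` picks `f u₀` for some `u₀ ∈ U` missed by `M`;
this leaves `v₀` at ⊥.

König is proved from Berge's bicolouring: balancedness makes the graph of pairs isolated by a
hypervertex bipartite (`Balanced.even_length_of_isCycle_traceGraph`), which allows a two-colouring
in which no hypervertex of degree at least two is monochromatic (`Balanced.exists_bicoloring`).
Recolouring pairs of classes gives edge colourings with maximum-degree many colours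
(`Balanced.exists_edgeColoring`), and a count of colour classes gives
`Balanced.exists_matching_cover`. -/

namespace SimpleGraph

/-! ### Parity of closed walks -/

theorem exists_isPath_even_length_iff {α : Type*} {G : SimpleGraph α}
    (hG : ∀ (u : α) (w : G.Walk u u), w.IsCycle → Even w.length) {u v : α} (p : G.Walk u v) :
    ∃ q : G.Walk u v, q.IsPath ∧ (Even q.length ↔ Even p.length) := by
  classical
  induction p with
  | nil => exact ⟨.nil, by simp, Iff.rfl⟩
  | @cons u v w h p ih =>
    obtain ⟨q, hq, hqp⟩ := ih
    by_cases hu : u ∈ q.support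
    -- The new edge and the prefix of `q` up to `u` close up to a cycle or a backtrack. Either way
    -- the prefix is odd, so dropping both preserves parity.
    · have hlen : (q.takeUntil u hu).length + (q.dropUntil u hu).length = q.length := by
        rw [← Walk.length_append, Walk.take_spec]
      have hpath := hq.takeUntil hu
      have hodd : ¬ Even (q.takeUntil u hu).length := by
        intro he
        have hpos : 0 < (q.takeUntil u hu).length := by
          rw [Nat.pos_iff_ne_zero]
          intro h0
          exact h.ne (Walk.eq_of_length_eq_zero h0).symm
        have hc : (Walk.cons h (q.takeUntil u hu)).IsCycle := by
          rw [Walk.isCycle_iff_isPath_tail_and_le_length]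
          refine ⟨by simpa using hpath, ?_⟩
          obtain ⟨m, hm⟩ := he
          simp only [Walk.length_cons]
          omega
        have := hG _ _ hc
        rw [Walk.length_cons, Nat.even_add_one] at this
        exact this he
      refine ⟨q.dropUntil u hu, hq.dropUntil hu, ?_⟩
      rw [Walk.length_cons, Nat.even_add_one, ← hqp, ← hlen, Nat.even_add]
      tauto
    · exact ⟨.cons h q, (Walk.cons_isPath_iff h q).2 ⟨hq, hu⟩, by
        simp only [Walk.length_cons, Nat.even_add_one, hqp]⟩

theorem even_length_of_forall_isCycle {α : Type*} {G : SimpleGraph α}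
    (hG : ∀ (u : α) (w : G.Walk u u), w.IsCycle → Even w.length) {u : α} (p : G.Walk u u) :
    Even p.length := by
  obtain ⟨q, hq, hqp⟩ := exists_isPath_even_length_iff hG p
  rw [← hqp, Walk.length_eq_zero_iff.2 (Walk.isPath_iff_nil.1 hq)]
  exact Even.zero

end SimpleGraph

/-! ### Lifting cycles to the incidence graph -/

namespace IncHypergraph

variable {V E ι : Type*} {H : IncHypergraph V E} {g : ι → E}

/-- A walk in a graph on `ι` whose edges `s(i, j)` are represented by hypervertices common to the
hyperedges `g i` and `g j`, lifted to the incidence graph. -/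
def liftWalk {G : SimpleGraph ι} {φ : Sym2 ι → V}
    (hφ : ∀ i j, G.Adj i j → H.Inc (φ s(i, j)) (g i) ∧ H.Inc (φ s(i, j)) (g j)) {i j : ι} :
    G.Walk i j → H.graph.Walk (Sum.inr (g i)) (Sum.inr (g j))
  | .nil => .nil
  | .cons (v := k) h p =>
    .cons (show H.graph.Adj (Sum.inr (g i)) (Sum.inl (φ s(i, k))) from (hφ i k h).1)
      (.cons (show H.graph.Adj (Sum.inl (φ s(i, k))) (Sum.inr (g k)) from (hφ i k h).2)
        (liftWalk hφ p))

section liftWalk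

variable {G : SimpleGraph ι} {φ : Sym2 ι → V}
  (hφ : ∀ i j, G.Adj i j → H.Inc (φ s(i, j)) (g i) ∧ H.Inc (φ s(i, j)) (g j))

theorem length_liftWalk {i j : ι} (p : G.Walk i j) :
    (liftWalk hφ p).length = 2 * p.length := by
  induction p with
  | nil => rfl
  | cons h p ih => simp only [liftWalk, SimpleGraph.Walk.length_cons, ih]; ring

theorem inr_mem_support_liftWalk {i j : ι} (p : G.Walk i j) {e : E}
    (he : Sum.inr e ∈ (liftWalk hφ p).support) : ∃ k ∈ p.support, g k = e := by
  induction p with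
  | nil => simpa [liftWalk, eq_comm] using he
  | cons h p ih =>
    simp only [liftWalk, SimpleGraph.Walk.support_cons, List.mem_cons, Sum.inr.injEq,
      reduceCtorEq, false_or] at he
    rcases he with he | he
    · exact ⟨_, by simp, he.symm⟩
    · obtain ⟨k, hk, hke⟩ := ih he
      exact ⟨k, by simp [hk], hke⟩

theorem inl_mem_support_liftWalk {i j : ι} (p : G.Walk i j) {v : V}
    (hv : Sum.inl v ∈ (liftWalk hφ p).support) : ∃ a ∈ p.edges, φ a = v := by
  induction p with
  | nil => simp [liftWalk] at hv
  | cons h p ih =>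
    simp only [liftWalk, SimpleGraph.Walk.support_cons, List.mem_cons, Sum.inl.injEq,
      reduceCtorEq, false_or] at hv
    rcases hv with hv | hv
    · exact ⟨_, by simp, hv.symm⟩
    · obtain ⟨k, hk, hke⟩ := ih hv
      exact ⟨k, by simp [hk], hke⟩

theorem mem_edges_liftWalk {i j : ι} (p : G.Walk i j) {a : Sym2 ι} (ha : a ∈ p.edges) {k : ι}
    (hk : k ∈ a) : s(Sum.inl (φ a), Sum.inr (g k)) ∈ (liftWalk hφ p).edges := by
  induction p with
  | nil => simp at ha
  | cons h p ih =>
    rw [SimpleGraph.Walk.edges_cons, List.mem_cons] at ha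
    simp only [liftWalk, SimpleGraph.Walk.edges_cons, List.mem_cons]
    rcases ha with rfl | ha
    · rcases Sym2.mem_iff.1 hk with rfl | rfl
      · exact Or.inl Sym2.eq_swap
      · exact Or.inr (Or.inl rfl)
    · exact Or.inr (Or.inr (ih ha))

theorem isPath_liftWalk (hinj : Set.InjOn φ G.edgeSet) {i j : ι} (p : G.Walk i j)
    (hp : p.IsPath) (hg : Set.InjOn g {k | k ∈ p.support}) : (liftWalk hφ p).IsPath := by
  induction p with
  | nil => simp [liftWalk]
  | @cons i k j h p ih =>
    rw [SimpleGraph.Walk.cons_isPath_iff] at hp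
    simp only [liftWalk, SimpleGraph.Walk.cons_isPath_iff, SimpleGraph.Walk.support_cons,
      List.mem_cons, reduceCtorEq, false_or]
    refine ⟨⟨ih hp.1 (hg.mono fun x hx => by simp_all), fun hv => ?_⟩, fun he => ?_⟩
    · obtain ⟨a, ha, hae⟩ := inl_mem_support_liftWalk hφ p hv
      have := hinj (p.edges_subset_edgeSet ha) (G.mem_edgeSet.2 h) hae
      subst this
      exact hp.2 (p.fst_mem_support_of_mem_edges ha)
    · obtain ⟨m, hm, hme⟩ := inr_mem_support_liftWalk hφ p he
      have : m = i := hg (by simp [hm]) (by simp) hme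
      exact hp.2 (this ▸ hm)

theorem isCycle_liftWalk (hinj : Set.InjOn φ G.edgeSet) {i : ι} (p : G.Walk i i)
    (hp : p.IsCycle) (hg : Set.InjOn g {k | k ∈ p.support}) : (liftWalk hφ p).IsCycle := by
  cases p with
  | nil => simp at hp
  | @cons _ k _ h p =>
    rw [SimpleGraph.Walk.cons_isCycle_iff] at hp
    have hpath := isPath_liftWalk hφ hinj p hp.1 (hg.mono fun x hx => by simp_all)
    have hmid : Sum.inl (φ s(i, k)) ∉ (liftWalk hφ p).support := fun hv => by
      obtain ⟨a, ha, hae⟩ := inl_mem_support_liftWalk hφ p hv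
      have := hinj (p.edges_subset_edgeSet ha) (G.mem_edgeSet.2 h) hae
      exact hp.2 (this ▸ ha)
    rw [liftWalk, SimpleGraph.Walk.cons_isCycle_iff, SimpleGraph.Walk.cons_isPath_iff]
    refine ⟨⟨hpath, hmid⟩, fun he => ?_⟩
    rw [SimpleGraph.Walk.edges_cons, List.mem_cons] at he
    rcases he with he | he
    · rw [Sym2.eq_swap, Sym2.congr_right, Sum.inr.injEq] at he
      exact h.ne (hg (by simp) (by simp) he)
    · exact hmid (SimpleGraph.Walk.snd_mem_support_of_mem_edges _ he)

end liftWalk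

/-! ### Bicolouring balanced hypergraphs -/

/-- Indices `i ≠ j` are adjacent if some hypervertex is incident to `g i` and `g j`, and to no
other hyperedge of the family `g` restricted to `S`. -/
def traceGraph (H : IncHypergraph V E) (g : ι → E) (S : Set ι) : SimpleGraph ι where
  Adj i j := i ≠ j ∧ ∃ v, ∀ k, k ∈ S ∧ H.Inc v (g k) ↔ k ∈ s(i, j)
  symm := ⟨fun i j h => ⟨h.1.symm, by simpa only [Sym2.eq_swap] using h.2⟩⟩
  loopless := ⟨fun _ h => h.1 rfl⟩

theorem mem_of_traceGraph_adj {S : Set ι} {i j : ι} (h : (H.traceGraph g S).Adj i j) : i ∈ S := by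
  obtain ⟨-, v, hv⟩ := h
  exact ((hv i).2 (Sym2.mem_mk_left i j)).1

/-- A cycle of length `2m + 1` would lift to one of length `4m + 2`. The lift has no chords, since
each chosen hypervertex meets exactly two members of the family on `S`. -/
theorem Balanced.even_length_of_isCycle_traceGraph (hH : H.Balanced) {S : Set ι} {i : ι}
    (C : (H.traceGraph g S).Walk i i) (hC : C.IsCycle) : Even C.length := by
  classical
  by_contra hodd
  rw [Nat.not_even_iff_odd] at hodd
  -- Choosing per unordered pair makes `φ` injective on edges; off the edges its value is an
  -- arbitrary `v₀`.
  have hex : ∀ a : Sym2 ι, ∃ v, a ∈ (H.traceGraph g S).edgeSet →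
      ∀ k, k ∈ S ∧ H.Inc v (g k) ↔ k ∈ a := by
    obtain ⟨v₀, -⟩ : ∃ v : V, True := by
      cases C with
      | nil => simp at hC
      | cons h p => exact ⟨h.2.choose, trivial⟩
    intro a
    induction a with
    | _ i j =>
      by_cases h : (H.traceGraph g S).Adj i j
      · exact ⟨h.2.choose, fun _ => h.2.choose_spec⟩
      · exact ⟨v₀, fun h' => absurd h' h⟩
  choose φ hφ using hex
  have hinj : Set.InjOn φ (H.traceGraph g S).edgeSet := by
    intro a ha b hb hab
    ext k
    rw [← hφ a ha, ← hφ b hb, hab]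
  have hφ' : ∀ i j, (H.traceGraph g S).Adj i j →
      H.Inc (φ s(i, j)) (g i) ∧ H.Inc (φ s(i, j)) (g j) := fun i j h =>
    ⟨((hφ s(i, j) h i).2 (by simp)).2, ((hφ s(i, j) h j).2 (by simp)).2⟩
  have hnbr : ∀ k ∈ C.support, ∃ a b, a ≠ b ∧ (H.traceGraph g S).Adj k a ∧
      (H.traceGraph g S).Adj k b := by
    intro k hk
    obtain ⟨a, b, hab, hs⟩ := Set.ncard_eq_two.1 (hC.ncard_neighborSet_toSubgraph_eq_two hk)
    have ha : a ∈ C.toSubgraph.neighborSet k := by rw [hs]; simp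
    have hb : b ∈ C.toSubgraph.neighborSet k := by rw [hs]; simp
    exact ⟨a, b, hab, C.toSubgraph.adj_sub ha, C.toSubgraph.adj_sub hb⟩
  have hS : ∀ k ∈ C.support, k ∈ S := fun k hk => by
    obtain ⟨a, -, -, ha, -⟩ := hnbr k hk
    exact mem_of_traceGraph_adj ha
  -- A parallel copy `l` of `k` would lie in both `s(k, a)` and `s(k, b)` with `a ≠ b`, forcing `l =
  -- k`.
  have hg : Set.InjOn g {k | k ∈ C.support} := by
    intro k hk l hl hkl
    obtain ⟨a, b, hab, ha, hb⟩ := hnbr k hk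
    have h1 := (hφ s(k, a) ha l).1 ⟨hS l hl, hkl ▸ (hφ' k a ha).1⟩
    have h2 := (hφ s(k, b) hb l).1 ⟨hS l hl, hkl ▸ (hφ' k b hb).1⟩
    rw [Sym2.mem_iff] at h1 h2
    grind
  have hchord : ∀ v e, Sum.inl v ∈ (liftWalk hφ' C).support →
      Sum.inr e ∈ (liftWalk hφ' C).support → H.Inc v e →
      s(Sum.inl v, Sum.inr e) ∈ (liftWalk hφ' C).edges := by
    intro v e hv he hve
    obtain ⟨a, ha, rfl⟩ := inl_mem_support_liftWalk hφ' C hv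
    obtain ⟨k, hk, rfl⟩ := inr_mem_support_liftWalk hφ' C he
    exact mem_edges_liftWalk hφ' C ha
      ((hφ a (C.edges_subset_edgeSet ha) k).1 ⟨hS k hk, hve⟩)
  obtain ⟨m, hm⟩ := hodd
  have h3 := hC.three_le_length
  refine hH _ (liftWalk hφ' C) ⟨isCycle_liftWalk hφ' hinj C hC hg, ?_⟩ m (by omega) ?_
  · rintro (v | e) hx (w | f) hy hadj
    · exact hadj.elim
    · exact hchord v f hx hy hadj
    · rw [Sym2.eq_swap]
      exact hchord w e hy hx hadj
    · exact hadj.elim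
  · rw [length_liftWalk, hm]; ring

/-- Induction on `S`, removing a non-cut vertex `x` of a component of the trace graph. Only
hypervertices meeting `x` and exactly one other index constrain the colour of `x`, and these others
are its trace neighbours. -/
theorem Balanced.exists_bicoloring [Finite ι] (hH : H.Balanced) (g : ι → E) (S : Set ι) :
    ∃ c : ι → Bool, ∀ v, ∀ i ∈ S, ∀ j ∈ S, i ≠ j → H.Inc v (g i) → H.Inc v (g j) →
      ∃ k ∈ S, ∃ l ∈ S, H.Inc v (g k) ∧ H.Inc v (g l) ∧ c k ≠ c l := by
  classical
  induction hn : S.ncard generalizing S with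
  | zero =>
    rw [Set.ncard_eq_zero] at hn
    subst hn
    exact ⟨fun _ => true, by simp⟩
  | succ n ih =>
    obtain ⟨i₀, hi₀⟩ : S.Nonempty := Set.nonempty_of_ncard_ne_zero (by omega)
    let G := H.traceGraph g S
    let K := G.connectedComponentMk i₀
    obtain ⟨⟨x, hxK⟩, hx⟩ :=
      K.connected_toSimpleGraph.exists_preconnected_induce_compl_singleton_of_finite
    have hxS : x ∈ S := by
      obtain ⟨p⟩ := SimpleGraph.ConnectedComponent.exact hxK
      cases p with
      | nil => exact hi₀
      | cons h p => exact mem_of_traceGraph_adj h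
    obtain ⟨c, hc⟩ := ih (S \ {x}) (by rw [Set.ncard_sdiff_singleton_of_mem hxS, hn]; rfl)
    have hval : ∀ i j, i ≠ x → j ≠ x → G.Adj i j → c i ≠ c j := by
      rintro i j hi hj ⟨hij, v, hv⟩
      have h1 := (hv i).2 (by simp)
      have h2 := (hv j).2 (by simp)
      obtain ⟨k, hk, l, hl, hvk, hvl, hkl⟩ := hc v i ⟨h1.1, hi⟩ j ⟨h2.1, hj⟩ hij h1.2 h2.2
      have h3 := Sym2.mem_iff.1 ((hv k).1 ⟨hk.1, hvk⟩)
      have h4 := Sym2.mem_iff.1 ((hv l).1 ⟨hl.1, hvl⟩)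
      grind
    -- A walk from `y` to `z` avoiding `x` alternates colours, and it closes through `x` to an even
    -- walk.
    have hsame : ∀ y z, G.Adj x y → G.Adj x z → c y = c z := by
      intro y z hy hz
      have hyK : y ∈ K := K.mem_supp_of_adj_mem_supp hxK hy
      have hzK : z ∈ K := K.mem_supp_of_adj_mem_supp hxK hz
      obtain ⟨p⟩ := hx ⟨⟨y, hyK⟩, fun h => hy.ne (congrArg Subtype.val h).symm⟩
        ⟨⟨z, hzK⟩, fun h => hz.ne (congrArg Subtype.val h).symm⟩
      let col : (K.toSimpleGraph.induce {(⟨x, hxK⟩ : K)}ᶜ).Coloring Bool :=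
        SimpleGraph.Coloring.mk (fun i => c i.1.1) fun {i j} h =>
          hval _ _ (fun h' => i.2 (Subtype.ext h')) (fun h' => j.2 (Subtype.ext h')) h
      let q : G.Walk y z := (p.map (SimpleGraph.Embedding.induce _).toHom).map K.toSimpleGraph_hom
      have hq : q.length = p.length :=
        (SimpleGraph.Walk.length_map _ _).trans (SimpleGraph.Walk.length_map _ _)
      have heven := SimpleGraph.even_length_of_forall_isCycle
        (fun u w hw => hH.even_length_of_isCycle_traceGraph w hw)
        (SimpleGraph.Walk.cons hy (q.concat hz.symm))
      rw [SimpleGraph.Walk.length_cons, SimpleGraph.Walk.length_concat, hq] at heven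
      have hp : Even p.length := by
        rw [Nat.even_add_one, Nat.even_add_one, not_not] at heven
        exact heven
      exact Bool.eq_iff_iff.2 ((col.even_length_iff_congr p).1 hp)
    obtain ⟨b, hb⟩ : ∃ b, ∀ y, G.Adj x y → c y ≠ b := by
      by_cases h : ∃ y, G.Adj x y
      · obtain ⟨y, hy⟩ := h
        exact ⟨!c y, fun z hz => by simp [hsame y z hy hz]⟩
      · exact ⟨true, fun y hy => absurd ⟨y, hy⟩ h⟩
    refine ⟨Function.update c x b, fun v i hi j hj hij hvi hvj => ?_⟩
    have hfar : ∀ i ∈ S \ {x}, ∀ j ∈ S \ {x}, i ≠ j → H.Inc v (g i) → H.Inc v (g j) →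
        ∃ k ∈ S, ∃ l ∈ S, H.Inc v (g k) ∧ H.Inc v (g l) ∧
          Function.update c x b k ≠ Function.update c x b l := by
      intro i hi j hj hij hvi hvj
      obtain ⟨k, hk, l, hl, hvk, hvl, hkl⟩ := hc v i hi j hj hij hvi hvj
      refine ⟨k, hk.1, l, hl.1, hvk, hvl, ?_⟩
      rwa [Function.update_of_ne hk.2, Function.update_of_ne hl.2]
    have hnear : ∀ j ∈ S, j ≠ x → H.Inc v (g x) → H.Inc v (g j) →
        ∃ k ∈ S, ∃ l ∈ S, H.Inc v (g k) ∧ H.Inc v (g l) ∧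
          Function.update c x b k ≠ Function.update c x b l := by
      intro j hj hjx hvx hvj
      by_cases h : ∃ k ∈ S, k ≠ x ∧ k ≠ j ∧ H.Inc v (g k)
      · obtain ⟨k, hk, hkx, hkj, hvk⟩ := h
        exact hfar k ⟨hk, hkx⟩ j ⟨hj, hjx⟩ hkj hvk hvj
      · refine ⟨j, hj, x, hxS, hvj, hvx, ?_⟩
        rw [Function.update_of_ne hjx, Function.update_self]
        refine hb j ⟨hjx.symm, v, fun k => ?_⟩
        rw [Sym2.mem_iff]
        constructor
        · rintro ⟨hk, hvk⟩
          by_contra hne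
          exact h ⟨k, hk, fun h => hne (.inl h), fun h => hne (.inr h), hvk⟩
        · rintro (rfl | rfl)
          exacts [⟨hxS, hvx⟩, ⟨hj, hvj⟩]
    by_cases hix : i = x
    · exact hnear j hj (hix ▸ hij.symm) (hix ▸ hvi) hvj
    · by_cases hjx : j = x
      · exact hnear i hi hix (hjx ▸ hvj) hvi
      · exact hfar i ⟨hi, hix⟩ j ⟨hj, hjx⟩ hij hvi hvj

end IncHypergraph

/-! ### Edge colouring and the König property -/

namespace IncHypergraph

theorem Balanced.exists_edgeColoring {V E ι : Type*} [Finite V] [Finite ι]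
    {H : IncHypergraph V E} (hH : H.Balanced) (g : ι → E) {k : ℕ} (hk : 0 < k)
    (hdeg : ∀ v, {i | H.Inc v (g i)}.ncard ≤ k) :
    ∃ c : ι → Fin k, ∀ v i j, H.Inc v (g i) → H.Inc v (g j) → c i = c j → i = j := by
  classical
  have := Fintype.ofFinite V
  have := Fintype.ofFinite ι
  have : Nonempty (Fin k) := ⟨⟨0, hk⟩⟩
  let I : V → Finset ι := fun v => Finset.univ.filter fun i => H.Inc v (g i)
  have hI : ∀ v i, i ∈ I v ↔ H.Inc v (g i) := by simp [I]
  -- Maximise the total number of colours seen. A repeated colour at `v` leaves some `b` missing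
  -- there, and bicolouring the classes of `c i` and `b` increases the total.
  obtain ⟨c, hc⟩ := Finite.exists_max
    fun c : ι → Fin k => ∑ v, ((I v).image c).card
  refine ⟨c, fun v i j hi hj hij => ?_⟩
  by_contra hne
  obtain ⟨b, hb⟩ : ∃ b, b ∉ (I v).image c := by
    by_contra! hall
    have h1 : ((I v).image c).card = k := by
      rw [Finset.eq_univ_of_forall hall, Finset.card_univ, Fintype.card_fin]
    have h2 : (I v).card ≤ k := by
      refine le_trans (le_of_eq ?_) (hdeg v)
      rw [← Set.ncard_coe_finset]
      congr 1
      ext i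
      simp [I]
    have h3 : (I v).card ≤ ((I v).image c).card := by rw [h1]; exact h2
    exact hne (Finset.card_image_iff.1 (le_antisymm Finset.card_image_le h3)
      ((hI v i).2 hi) ((hI v j).2 hj) hij)
  have hab : c i ≠ b := fun h => hb (Finset.mem_image.2 ⟨i, (hI v i).2 hi, h⟩)
  obtain ⟨χ, hχ⟩ := hH.exists_bicoloring g {l | c l = c i ∨ c l = b}
  let c' : ι → Fin k := fun l => if c l = c i ∨ c l = b then (if χ l then c i else b) else c l
  have hc'1 : ∀ l, c l ≠ c i → c l ≠ b → c' l = c l := fun l h1 h2 => by simp [c', h1, h2]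
  have hc'2 : ∀ l, c l = c i ∨ c l = b → c' l = if χ l then c i else b := fun l h => by
    simp only [c', if_pos h]
  have hboth : ∀ u, ∀ l m, l ≠ m → (c l = c i ∨ c l = b) → (c m = c i ∨ c m = b) →
      H.Inc u (g l) → H.Inc u (g m) → c i ∈ (I u).image c' ∧ b ∈ (I u).image c' := by
    intro u l m hlm hl hm hul hum
    obtain ⟨p, hp, q, hq, hup, huq, hpq⟩ := hχ u l hl m hm hlm hul hum
    have hp' := hc'2 p hp
    have hq' := hc'2 q hq
    cases hχp : χ p <;> cases hχq : χ q <;> simp_all <;> grind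
  have hout : ∀ u d, d ≠ c i → d ≠ b → (d ∈ (I u).image c ↔ d ∈ (I u).image c') := by
    intro u d hd1 hd2
    simp only [Finset.mem_image]
    refine exists_congr fun l => and_congr_right fun _ => ?_
    by_cases h : c l = c i ∨ c l = b
    · rw [hc'2 l h]
      grind
    · push Not at h
      rw [hc'1 l h.1 h.2]
  have hle : ∀ u, ((I u).image c).card ≤ ((I u).image c').card := by
    intro u
    by_cases h2 : ∃ l m, l ≠ m ∧ (c l = c i ∨ c l = b) ∧ (c m = c i ∨ c m = b) ∧
        H.Inc u (g l) ∧ H.Inc u (g m)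
    · obtain ⟨l, m, hlm, hl, hm, hul, hum⟩ := h2
      obtain ⟨ha, hb'⟩ := hboth u l m hlm hl hm hul hum
      refine Finset.card_le_card fun d hd => ?_
      by_cases hd1 : d = c i
      · rwa [hd1]
      by_cases hd2 : d = b
      · rwa [hd2]
      exact (hout u d hd1 hd2).1 hd
    · -- At most one index at `u` is recoloured, so the recolouring factors through the colours.
      let τ : Fin k → Fin k := fun d =>
        if h : ∃ l ∈ I u, c' l = d then c h.choose else d
      refine Finset.card_le_card_of_surjOn τ ?_
      intro d hd
      obtain ⟨l, hl, rfl⟩ := Finset.mem_image.1 (Finset.mem_coe.1 hd)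
      refine ⟨c' l, Finset.mem_coe.2 (Finset.mem_image_of_mem _ hl), ?_⟩
      have hex : ∃ m ∈ I u, c' m = c' l := ⟨l, hl, rfl⟩
      simp only [τ, dif_pos hex]
      obtain ⟨hm, hml⟩ := hex.choose_spec
      generalize hex.choose = m at hm hml
      rw [hI] at hm hl
      by_cases h : m = l
      · rw [h]
      have hnot : ¬ ((c l = c i ∨ c l = b) ∧ (c m = c i ∨ c m = b)) := fun h' =>
        h2 ⟨l, m, Ne.symm h, h'.1, h'.2, hl, hm⟩
      simp only [c'] at hml
      grind
  have hlt : ((I v).image c).card < ((I v).image c').card := by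
    obtain ⟨ha, hb'⟩ := hboth v i j hne (.inl rfl) (.inl hij.symm) hi hj
    refine Finset.card_lt_card ((Finset.ssubset_iff_of_subset fun d hd => ?_).2 ⟨b, hb', hb⟩)
    by_cases hd1 : d = c i
    · rwa [hd1]
    by_cases hd2 : d = b
    · rwa [hd2]
    exact (hout v d hd1 hd2).1 hd
  exact absurd (hc c') (not_le.2 (Finset.sum_lt_sum (fun u _ => hle u) ⟨v, Finset.mem_univ v, hlt⟩))

/-- The König property of balanced hypergraphs: some matching has as many members as some set of
hypervertices meeting all the hyperedges. -/
theorem Balanced.exists_matching_cover {V E : Type*} [Finite V] [Finite E]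
    {H : IncHypergraph V E} (hH : H.Balanced) (hne : ∀ e, ∃ v, H.Inc v e) (F : Set E) :
    ∃ M ⊆ F, H.IsMatching M ∧ ∃ B : Set V, (∀ e ∈ F, ∃ v ∈ B, H.Inc v e) ∧
      B.ncard ≤ M.ncard := by
  classical
  have := Fintype.ofFinite V
  have := Fintype.ofFinite E
  induction hn : F.ncard using Nat.strong_induction_on generalizing F with
  | _ n ih =>
  obtain ⟨M, ⟨hMF, hM⟩, hmax⟩ : ∃ M, (M ⊆ F ∧ H.IsMatching M) ∧
      ∀ M', M' ⊆ F → H.IsMatching M' → M'.ncard ≤ M.ncard := by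
    have hfin : {M : Set E | M ⊆ F ∧ H.IsMatching M}.Finite := Set.toFinite _
    obtain ⟨M, hM, hmax⟩ := hfin.exists_maximalFor Set.ncard _
      ⟨∅, Set.empty_subset _, fun v => by simp⟩
    refine ⟨M, hM, fun M' h1 h2 => ?_⟩
    by_contra! hlt
    exact absurd (hmax ⟨h1, h2⟩ hlt.le) (not_le.2 hlt)
  rcases F.eq_empty_or_nonempty with rfl | ⟨e₀, he₀⟩
  · exact ⟨∅, Set.Subset.rfl, fun v => by simp, ∅, by simp, by simp⟩
  have hpos : 0 < M.ncard := by
    have := hmax {e₀} (by simpa using he₀) fun v =>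
      Set.subsingleton_singleton.anti Set.inter_subset_right
    rw [Set.ncard_singleton] at this
    omega
  -- If every maximum matching covers some `x`, delete the hyperedges at `x` and add `x` to the
  -- cover of the rest.
  by_cases hx : ∃ x, ∀ M' ⊆ F, H.IsMatching M' → (∀ e ∈ M', ¬ H.Inc x e) →
      M'.ncard < M.ncard
  · obtain ⟨x, hx⟩ := hx
    have hlt : {e ∈ F | ¬ H.Inc x e}.ncard < n := by
      rw [← hn]
      refine Set.ncard_lt_ncard ⟨Set.sep_subset _ _, fun hsub => ?_⟩
      exact lt_irrefl _ (hx M hMF hM fun e he => (hsub (hMF he)).2)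
    obtain ⟨M', hM'F, hM', B, hB, hcard⟩ := ih _ hlt {e ∈ F | ¬ H.Inc x e} rfl
    have hM'lt := hx M' (fun e he => (hM'F he).1) hM' fun e he => (hM'F he).2
    refine ⟨M, hMF, hM, insert x B, fun e he => ?_, ?_⟩
    · by_cases hxe : H.Inc x e
      · exact ⟨x, Set.mem_insert _ _, hxe⟩
      · obtain ⟨v, hv, hve⟩ := hB e ⟨he, hxe⟩
        exact ⟨v, Set.mem_insert_of_mem _ hv, hve⟩
    · have := Set.ncard_insert_le x B
      omega
  · exfalso
    push Not at hx
    choose N hNF hN hNx hNcard using hx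
    -- Pool, with multiplicity, one maximum matching avoiding each `x`. Degrees are at most `|V| -
    -- 1`, so the pool splits into `|V| - 1` matchings, too few to hold `|V| * |M|` members.
    let ι := Σ x : V, N x
    let g : ι → E := fun i => i.2.1
    have hinj : ∀ v (i j : ι), H.Inc v (g i) → H.Inc v (g j) → i.1 = j.1 → i = j := by
      rintro v ⟨x, e, he⟩ ⟨y, f, hf⟩ hi hj hxy
      obtain rfl : x = y := hxy
      obtain rfl : e = f := hN x v ⟨hi, he⟩ ⟨hj, hf⟩
      rfl
    have hdeg : ∀ v, {i : ι | H.Inc v (g i)}.ncard ≤ Fintype.card V - 1 := by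
      intro v
      rw [← Finset.card_univ, ← Finset.card_erase_of_mem (Finset.mem_univ v),
        ← Set.ncard_coe_finset]
      refine Set.ncard_le_ncard_of_injOn (fun i : ι => i.1) (fun i hi => ?_)
        (fun i hi j hj hij => hinj v i j hi hj hij)
      simp only [Finset.coe_erase, Finset.coe_univ, Set.mem_sdiff, Set.mem_univ, true_and,
        Set.mem_singleton_iff]
      exact fun h => hNx i.1 i.2.1 i.2.2 (h ▸ hi)
    obtain ⟨v₀, -⟩ := hne e₀
    have hcardι : Fintype.card V * M.ncard ≤ Nat.card ι := by
      rw [Nat.card_sigma, ← smul_eq_mul, ← Finset.card_univ, ← Finset.sum_const]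
      exact Finset.sum_le_sum fun x _ => hNcard x
    have hVpos : 0 < Fintype.card V := Fintype.card_pos_iff.2 ⟨v₀⟩
    have hk : 0 < Fintype.card V - 1 := by
      have : 0 < Nat.card ι := lt_of_lt_of_le (Nat.mul_pos hVpos hpos) hcardι
      obtain ⟨⟨i⟩, -⟩ := Nat.card_pos_iff.1 this
      obtain ⟨v, hv⟩ := hne (g i)
      exact lt_of_lt_of_le ((Set.ncard_pos).2 ⟨i, hv⟩) (hdeg v)
    obtain ⟨c, hc⟩ := hH.exists_edgeColoring g hk hdeg
    have hclass : ∀ a, (Finset.univ.filter fun i => c i = a).card ≤ M.ncard := by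
      intro a
      -- Copies of one hyperedge share a hypervertex, so they get different colours.
      have h1 : Set.InjOn g {i | c i = a} := by
        intro i hi j hj hij
        obtain ⟨v, hv⟩ := hne (g i)
        exact hc v i j hv (hij ▸ hv) (Eq.trans hi (Eq.symm hj))
      have h2 := hmax (g '' {i | c i = a}) (by rintro _ ⟨i, -, rfl⟩; exact hNF _ i.2.2) (by
        rintro v _ ⟨hv, i, hi, rfl⟩ _ ⟨hv', j, hj, rfl⟩
        exact congrArg g (hc v i j hv hv' (Eq.trans hi (Eq.symm hj))))
      rw [h1.ncard_image] at h2
      rw [← Set.ncard_coe_finset]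
      simpa using h2
    have hle : Nat.card ι ≤ (Fintype.card V - 1) * M.ncard := by
      rw [Nat.card_eq_fintype_card, ← Finset.card_univ,
        Finset.card_eq_sum_card_fiberwise (f := c) (t := Finset.univ) (fun _ _ => by simp)]
      refine (Finset.sum_le_sum fun a _ => hclass a).trans ?_
      simp
    have := hcardι.trans hle
    have := Nat.le_of_mul_le_mul_right this hpos
    omega

end IncHypergraph

/-! ### Constructing the assignments -/

namespace IncHypergraph

variable {V E : Type*} {H : IncHypergraph V E} {U : Set V}

/-- Independence makes `u` the only element of `U` on its matching edge, which gives `winning`;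
transversality gives `losing` at the old hyperedges. -/
theorem exists_isAssignment_of_covers (hUi : H.IsIndependent U) (hUt : H.IsTransversal U)
    {M : Set E} (hM : H.IsMatching M) (hMU : H.Covers M U) :
    ∃ (R : Set (AugVertex V)) (σ : AugVertex V → Option (AugEdge E U)),
      (H.augment U).IsAssignment .v₀ R σ ∧ σ .v₀ ≠ none := by
  classical
  choose m hm using fun u : U => hMU u u.2
  have hmu : ∀ u v (hv : v ∈ U), u ∈ U → H.Inc u (m ⟨v, hv⟩) → u = v := fun u v hv hu h =>
    hUi _ ⟨h, hu⟩ ⟨(hm ⟨v, hv⟩).1, hv⟩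
  let σ : AugVertex V → Option (AugEdge E U)
    | .v₀ => some .e₀
    | .v₁ => none
    | .old u => if h : u ∈ U then some (.old (m ⟨u, h⟩)) else none
  have hσ : ∀ u (h : u ∈ U), σ (.old u) = some (.old (m ⟨u, h⟩)) := fun u h => dif_pos h
  have hσ' : ∀ u e, σ (.old u) = some e → ∃ h : u ∈ U, e = .old (m ⟨u, h⟩) := by
    intro u e hu
    by_cases h : u ∈ U
    · exact ⟨h, by rw [hσ u h] at hu; exact (Option.some.inj hu).symm⟩
    · rw [show σ (.old u) = none from dif_neg h] at hu
      cases hu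
  refine ⟨Set.univ, σ, ⟨Set.mem_univ _, ?_, ?_, ?_, ?_⟩, Option.some_ne_none _⟩
  · rintro (_ | _ | v) - e he
    · cases he
      refine ⟨trivial, ?_⟩
      rintro (_ | _ | u) hu hne
      exacts [absurd rfl hne, ⟨trivial, rfl⟩, hu.elim]
    · cases he
    · obtain ⟨hv, rfl⟩ := hσ' v e he
      refine ⟨(hm ⟨v, hv⟩).1, ?_⟩
      rintro (_ | _ | u) hu hne
      · exact hu.elim
      · exact hu.elim
      · refine ⟨trivial, dif_neg fun huU => hne ?_⟩
        rw [hmu u v hv huU hu]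
  · rintro v - hv (_ | u | e) he
    · exact ⟨.v₀, trivial, trivial, Option.some_ne_none _⟩
    · exact ⟨.old u, rfl, trivial, by rw [hσ u u.2]; exact Option.some_ne_none _⟩
    · obtain ⟨u, hue, huU⟩ := hUt e
      exact ⟨.old u, hue, trivial, by rw [hσ u huU]; exact Option.some_ne_none _⟩
  · rintro (_ | _ | v) - (_ | _ | a) ⟨ha, e, hae, he⟩ (_ | _ | b) ⟨hb, f, hbf, hf⟩ <;>
      first
        | rfl
        | exact absurd rfl ha
        | exact absurd rfl hb
        | (cases hae; done)
        | (cases hbf; done)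
        | (cases hae; exact he.elim)
        | (cases hbf; exact hf.elim)
        | (obtain ⟨_, h⟩ := hσ' _ _ hae; subst h; exact he.elim)
        | (obtain ⟨_, h⟩ := hσ' _ _ hbf; subst h; exact hf.elim)
        | skip
    obtain ⟨haU, rfl⟩ := hσ' _ _ hae
    obtain ⟨hbU, rfl⟩ := hσ' _ _ hbf
    have := hM v ⟨he, (hm ⟨a, haU⟩).2⟩ ⟨hf, (hm ⟨b, hbU⟩).2⟩
    have hba := (hm ⟨b, hbU⟩).1
    rw [← this] at hba
    rw [hmu b a haU hbU hba]
  · ext v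
    simp only [Set.mem_empty_iff_false, iff_false]
    rintro ⟨hne, e, hve, he⟩
    cases v with
    | v₀ => exact hne rfl
    | v₁ => cases hve
    | old v =>
      obtain ⟨_, h⟩ := hσ' v e hve
      rw [h] at he
      exact he

theorem exists_isAssignment_of_cover {M : Set E}
    (hM : H.IsMatching M) {B : Set V} (hB : ∀ e, ∃ v ∈ B, H.Inc v e) (hBfin : B.Finite)
    (hcard : B.ncard ≤ M.ncard) {u₀ : V} (hu₀ : u₀ ∈ U) (hu₀M : ∀ e ∈ M, ¬ H.Inc u₀ e) :
    ∃ (R : Set (AugVertex V)) (σ : AugVertex V → Option (AugEdge E U)),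
      (H.augment U).IsAssignment .v₀ R σ ∧ σ .v₀ = none := by
  classical
  choose φ hφB hφ using hB
  have hinj : Set.InjOn φ M := fun e he f hf hef => hM (φ e) ⟨hφ e, he⟩ ⟨hef ▸ hφ f, hf⟩
  -- Disjointness of `M` makes `φ` injective, so `|B| ≤ |M|` forces equality: each edge of `M` meets
  -- `B` exactly once.
  have himg : φ '' M = B :=
    Set.eq_of_subset_of_ncard_le (by rintro _ ⟨e, -, rfl⟩; exact hφB e)
      (by rwa [hinj.ncard_image]) hBfin
  have huniq : ∀ e ∈ M, ∀ v ∈ B, H.Inc v e → v = φ e := by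
    intro e he v hv hve
    rw [← himg] at hv
    obtain ⟨f, hf, rfl⟩ := hv
    rw [hM (φ f) ⟨hφ f, hf⟩ ⟨hve, he⟩]
  have hBM : ∀ v ∈ B, ∃ e ∈ M, H.Inc v e := by
    intro v hv
    rw [← himg] at hv
    obtain ⟨f, hf, rfl⟩ := hv
    exact ⟨f, hf, hφ f⟩
  choose m hmM hm using hBM
  let σ : AugVertex V → Option (AugEdge E U)
    | .v₀ => none
    | .v₁ => some (.f ⟨u₀, hu₀⟩)
    | .old v => if h : v ∈ B then some (.old (m v h)) else none
  have hσ : ∀ v (h : v ∈ B), σ (.old v) = some (.old (m v h)) := fun v h => dif_pos h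
  have hσ' : ∀ v e, σ (.old v) = some e → ∃ h : v ∈ B, e = .old (m v h) := by
    intro v e hv
    by_cases h : v ∈ B
    · exact ⟨h, by rw [hσ v h] at hv; exact (Option.some.inj hv).symm⟩
    · rw [show σ (.old v) = none from dif_neg h] at hv
      cases hv
  have hu₀B : u₀ ∉ B := fun h => hu₀M _ (hmM u₀ h) (hm u₀ h)
  refine ⟨Set.univ, σ, ⟨Set.mem_univ _, ?_, ?_, ?_, ?_⟩, rfl⟩
  · rintro (_ | _ | v) - e he
    · cases he
    · cases he
      refine ⟨trivial, ?_⟩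
      rintro (_ | _ | u) hu hne
      · exact ⟨trivial, rfl⟩
      · exact absurd rfl hne
      · obtain rfl : u = u₀ := hu
        exact ⟨trivial, dif_neg hu₀B⟩
    · obtain ⟨hv, rfl⟩ := hσ' v e he
      refine ⟨hm v hv, ?_⟩
      rintro (_ | _ | u) hu hne
      · exact hu.elim
      · exact hu.elim
      · refine ⟨trivial, dif_neg fun huB => hne ?_⟩
        rw [huniq _ (hmM v hv) u huB hu, ← huniq _ (hmM v hv) v hv (hm v hv)]
  · rintro v - hv (_ | u | e) he
    · exact ⟨.v₁, trivial, trivial, Option.some_ne_none _⟩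
    · exact ⟨.v₁, trivial, trivial, Option.some_ne_none _⟩
    · exact ⟨.old (φ e), hφ e, trivial, by rw [hσ _ (hφB e)]; exact Option.some_ne_none _⟩
  · have hold : ∀ v a e, σ (.old a) = some e → (H.augment U).Inc v e →
        ∃ w, v = .old w ∧ ∃ h : a ∈ B, H.Inc w (m a h) := by
      intro v a e hae he
      obtain ⟨haB, h⟩ := hσ' a e hae
      rw [h] at he
      cases v with
      | old w => exact ⟨w, rfl, haB, he⟩
      | _ => exact he.elim
    have hnew : ∀ w e, σ .v₁ = some e → (H.augment U).Inc (.old w) e → w = u₀ := by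
      intro w e h he
      cases h
      exact he
    -- The edge `f u₀` meets old hypervertices only in `u₀`, which lies on no edge of `M`.
    have hmix : ∀ v a e f, σ .v₁ = some e → (H.augment U).Inc v e →
        σ (.old a) = some f → (H.augment U).Inc v f → False := by
      intro v a e f h1 he h2 hf
      obtain ⟨w, rfl, haB, hw⟩ := hold v a f h2 hf
      obtain rfl := hnew w e h1 he
      exact hu₀M _ (hmM a haB) hw
    rintro v - (_ | _ | a) ⟨ha, e, hae, he⟩ (_ | _ | b) ⟨hb, f, hbf, hf⟩
    · rfl
    · cases hae
    · cases hae
    · cases hbf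
    · rfl
    · exact (hmix v b e f hae he hbf hf).elim
    · cases hbf
    · exact (hmix v a f e hbf hf hae he).elim
    · obtain ⟨w, rfl, haB, hw⟩ := hold v a e hae he
      obtain ⟨w', hww, hbB, hw'⟩ := hold _ b f hbf hf
      cases hww
      have h := hM w ⟨hw, hmM a haB⟩ ⟨hw', hmM b hbB⟩
      rw [huniq _ (hmM a haB) a haB (hm a haB), h, ← huniq _ (hmM b hbB) b hbB (hm b hbB)]
  · ext v
    simp only [Set.mem_empty_iff_false, iff_false]
    rintro ⟨hne, e, hve, he⟩
    cases v with
    | v₀ => exact hne rfl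
    | v₁ => cases hve; exact he
    | old v =>
      obtain ⟨_, h⟩ := hσ' v e hve
      rw [h] at he
      exact he

end IncHypergraph

theorem proposition6 {V E : Type*} [Finite V] [Finite E] (H : IncHypergraph V E)
    (hH : H.Balanced) (U : Set V) (hUi : H.IsIndependent U) (hUt : H.IsTransversal U) :
    ((∃ M : Set E, H.IsMatching M ∧ H.Covers M U) →
      ∃ (R : Set (IncHypergraph.AugVertex V))
        (σ : IncHypergraph.AugVertex V → Option (IncHypergraph.AugEdge E U)),
        (H.augment U).IsAssignment .v₀ R σ ∧ σ .v₀ ≠ none) ∧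
    ((¬ ∃ M : Set E, H.IsMatching M ∧ H.Covers M U) →
      ∃ (R : Set (IncHypergraph.AugVertex V))
        (σ : IncHypergraph.AugVertex V → Option (IncHypergraph.AugEdge E U)),
        (H.augment U).IsAssignment .v₀ R σ ∧ σ .v₀ = none) ∧
    (∃ (R : Set (IncHypergraph.AugVertex V))
        (σ : IncHypergraph.AugVertex V → Option (IncHypergraph.AugEdge E U)),
        (H.augment U).IsAssignment .v₀ R σ) := by
  classical
  have covered (h : ∃ M : Set E, H.IsMatching M ∧ H.Covers M U) :=
    let ⟨_, hM, hMU⟩ := h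
    IncHypergraph.exists_isAssignment_of_covers hUi hUt hM hMU
  have uncovered (h : ¬ ∃ M : Set E, H.IsMatching M ∧ H.Covers M U) :
      ∃ (R : Set (IncHypergraph.AugVertex V))
        (σ : IncHypergraph.AugVertex V → Option (IncHypergraph.AugEdge E U)),
        (H.augment U).IsAssignment .v₀ R σ ∧ σ .v₀ = none := by
    obtain ⟨M, -, hM, B, hB, hcard⟩ :=
      hH.exists_matching_cover (fun e => let ⟨v, hv, _⟩ := hUt e; ⟨v, hv⟩) Set.univ
    obtain ⟨u, huU, hu⟩ : ∃ u ∈ U, ∀ e ∈ M, ¬ H.Inc u e := by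
      by_contra! hall
      exact h ⟨M, hM, fun u hu => let ⟨e, he, hue⟩ := hall u hu; ⟨e, hue, he⟩⟩
    exact IncHypergraph.exists_isAssignment_of_cover hM (fun e => hB e trivial)
      B.toFinite hcard huU hu
  refine ⟨covered, uncovered, ?_⟩
  by_cases h : ∃ M : Set E, H.IsMatching M ∧ H.Covers M U
  · obtain ⟨R, σ, hRσ, -⟩ := covered h
    exact ⟨R, σ, hRσ⟩
  · obtain ⟨R, σ, hRσ, -⟩ := uncovered h
    exact ⟨R, σ, hRσ⟩
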